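/- Throughout, $\log=\log_2$, strings are finite binary strings, and $C^X(\sigma)$ is the plain Kolmogorov complexity of a string $\sigma$ relative to the oracle $X\subseteq\mathbb N$, that is, the length of a shortest string $p$ such that $U^X(p)=\sigma$, where $U$ is a fixed universal oracle machine (for each oracle machine $M$ there is a constant $d$ such that, for all $X$, $p$, $\sigma$, if $M^X(p)=\sigma$ then $U^X(q)=\sigma$ for some $q$ of length at most $|p|+d$). For a family $\mathcal F$ of sets of natural numbers put $C(\sigma\mid\mathcal F)=\max_{X\in\mathcal F}C^X(\sigma)$. Let $[A]^\omega$ be the family of infinite subsets of $A\subseteq\mathbb N$, let $0'$ be the halting problem, and let the lower density of $A$ be $\liminf_{n\to\infty}|A\cap\{0,\dots,n\}|/(n+1)$. For every universal oracle machine $U$ there is a constant $c$ such that for every string $\sigma$ and every real $\delta\in(0,1]$ there is a set $A\subseteq\mathbb N$ of lower density at least $\delta$ with $$C(\sigma\mid[A]^\omega)\;\le\;\max\bigl(0,\;C^{0'}(\sigma)-\log(1/\delta)\bigr)+c\cdot\log\bigl(2+\log(1/\delta)\bigr).$$ -/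

import Mathlib

open scoped ENNReal

noncomputable section

/-- Programs with access to an oracle: the programs for the partial recursive functions
(compare `Nat.RecursiveIn`) together with an instruction that queries the oracle. -/
inductive OracleCode : Type
  | zero : OracleCode
  | succ : OracleCode
  | left : OracleCode
  | right : OracleCode
  | query : OracleCode
  | pair : OracleCode → OracleCode → OracleCode
  | comp : OracleCode → OracleCode → OracleCode
  | prec : OracleCode → OracleCode → OracleCode
  | rfind : OracleCode → OracleCode

/-- The oracle given by a set `X ⊆ ℕ`: on query `n` it answers the bit `X(n)`. -/
def setOracle (X : Set ℕ) : ℕ → ℕ :=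
  open Classical in fun n => if n ∈ X then 1 else 0

namespace OracleCode

/-- The partial function computed by an oracle program when run with oracle `X`. -/
def eval (X : Set ℕ) : OracleCode → ℕ →. ℕ
  | zero => fun _ => Part.some 0
  | succ => fun n => Part.some (n + 1)
  | left => fun n => Part.some n.unpair.1
  | right => fun n => Part.some n.unpair.2
  | query => fun n => Part.some (setOracle X n)
  | pair f h => fun n => Nat.pair <$> f.eval X n <*> h.eval X n
  | comp f h => fun n => h.eval X n >>= f.eval X
  | prec f h => fun p =>
      Nat.rec (f.eval X p.unpair.1)
        (fun y IH => do
          let i ← IH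
          h.eval X (Nat.pair p.unpair.1 (Nat.pair y i)))
        p.unpair.2
  | rfind f => fun a =>
      Nat.rfind fun n => (fun m => decide (m = 0)) <$> f.eval X (Nat.pair a n)

/-- With oracle `X`, the program `M` halts on the binary string `p` and outputs the binary
string `σ`. Strings are represented by natural numbers through Mathlib's computable encoding. -/
def Outputs (M : OracleCode) (X : Set ℕ) (p σ : List Bool) : Prop :=
  Encodable.encode σ ∈ M.eval X (Encodable.encode p)

/-- `U` is a universal (additively optimal) oracle machine: it simulates every oracle machine `M`
with an increase of the program length by a constant depending on `M` only. -/
def IsUniversal (U : OracleCode) : Prop :=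
  ∀ M : OracleCode, ∃ d : ℕ, ∀ (X : Set ℕ) (p σ : List Bool), M.Outputs X p σ →
    ∃ q : List Bool, q.length ≤ p.length + d ∧ U.Outputs X q σ

/-- `C^X(σ)`: the length of a shortest `p` with `U^X(p) = σ` (and `⊤` if there is none). -/
def complexity (U : OracleCode) (X : Set ℕ) (σ : List Bool) : ℕ∞ :=
  ⨅ (p : List Bool) (_ : U.Outputs X p σ), (p.length : ℕ∞)

/-- `C(σ ∣ 𝓕)`: the maximum of `C^X(σ)` over `X ∈ 𝓕`. -/
def familyComplexity (U : OracleCode) (F : Set (Set ℕ)) (σ : List Bool) : ℕ∞ :=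
  ⨆ X ∈ F, U.complexity X σ

end OracleCode

/-- `0'`: the halting problem. -/
def zeroJump : Set ℕ :=
  {n | ((Denumerable.ofNat Nat.Partrec.Code n).eval n).Dom}

/-- `[A]^ω`: the family of infinite subsets of `A`. -/
def infiniteSubsets (A : Set ℕ) : Set (Set ℕ) :=
  {B | B ⊆ A ∧ B.Infinite}

/-- The lower density `liminf |A ∩ {0, …, n}| / (n + 1)` of `A ⊆ ℕ`. -/
def lowerDensity (A : Set ℕ) : ℝ :=
  Filter.liminf (fun n : ℕ => ((A ∩ Set.Iic n).ncard : ℝ) / (n + 1)) Filter.atTop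

namespace OracleCode

/-- Oracle programs compute exactly the functions that are recursive in the oracle. -/
theorem recursiveIn_iff_exists_code (X : Set ℕ) (f : ℕ →. ℕ) :
    Nat.RecursiveIn {fun n => Part.some (setOracle X n)} f ↔ ∃ c : OracleCode, c.eval X = f := by
  constructor
  · intro h
    induction h with
    | zero => exact ⟨zero, rfl⟩
    | succ => exact ⟨succ, rfl⟩
    | left => exact ⟨left, rfl⟩
    | right => exact ⟨right, rfl⟩
    | oracle g hg => exact ⟨query, hg.symm⟩
    | pair _ _ h1 h2 =>
      obtain ⟨c, rfl⟩ := h1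
      obtain ⟨d, rfl⟩ := h2
      exact ⟨pair c d, rfl⟩
    | comp _ _ h1 h2 =>
      obtain ⟨c, rfl⟩ := h1
      obtain ⟨d, rfl⟩ := h2
      exact ⟨comp c d, rfl⟩
    | prec _ _ h1 h2 =>
      obtain ⟨c, rfl⟩ := h1
      obtain ⟨d, rfl⟩ := h2
      exact ⟨prec c d, rfl⟩
    | rfind _ h1 =>
      obtain ⟨c, rfl⟩ := h1
      exact ⟨rfind c, rfl⟩
  · rintro ⟨c, rfl⟩
    induction c with
    | zero => exact .zero
    | succ => exact .succ
    | left => exact .left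
    | right => exact .right
    | query => exact .oracle _ rfl
    | pair _ _ h1 h2 => exact .pair h1 h2
    | comp _ _ h1 h2 => exact .comp h1 h2
    | prec _ _ h1 h2 => exact .prec h1 h2
    | rfind _ h1 => exact .rfind h1

/-- Partial recursive functions are computed by oracle programs that ignore the oracle. -/
theorem exists_code_of_partrec {f : ℕ →. ℕ} (hf : Nat.Partrec f) :
    ∃ c : OracleCode, ∀ X, c.eval X = f := by
  suffices h : ∃ c : OracleCode, ∀ X, ∀ n, c.eval X n = f n from
    h.imp fun c hc X => funext (hc X)
  induction hf with
  | zero => exact ⟨zero, fun _ _ => rfl⟩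
  | succ => exact ⟨succ, fun _ _ => rfl⟩
  | left => exact ⟨left, fun _ _ => rfl⟩
  | right => exact ⟨right, fun _ _ => rfl⟩
  | pair _ _ h1 h2 =>
    obtain ⟨c, hc⟩ := h1
    obtain ⟨d, hd⟩ := h2
    exact ⟨pair c d, fun X n => by simp [eval, hc, hd]⟩
  | comp _ _ h1 h2 =>
    obtain ⟨c, hc⟩ := h1
    obtain ⟨d, hd⟩ := h2
    exact ⟨comp c d, fun X n => by
      have h : c.eval X = _ := funext (hc X)
      simp only [eval, hd, h]⟩
  | prec _ _ h1 h2 =>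
    obtain ⟨c, hc⟩ := h1
    obtain ⟨d, hd⟩ := h2
    exact ⟨prec c d, fun X n => by simp [eval, hc, hd]⟩
  | rfind _ h1 =>
    obtain ⟨c, hc⟩ := h1
    exact ⟨rfind c, fun X n => by simp [eval, hc]⟩

/-- The first `l` answers of the oracle `X`. -/
def prefixList (X : Set ℕ) (l : ℕ) : List ℕ := (List.range l).map (setOracle X)

/-- One step of the bounded search in `approx`. -/
def searchStep (v : ℕ → Option ℕ) (j : ℕ) (r : Option (Option ℕ)) : Option (Option ℕ) :=
  r.bind fun o => Option.casesOn o
    ((v j).map fun m => if m = 0 then some j else none) fun m => some (some m)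

/-- The result of running an oracle program with a finite part of the oracle and with all
searches bounded by the length of that part. -/
def approx : OracleCode → List ℕ → ℕ → Option ℕ
  | zero => fun _ _ => some 0
  | succ => fun _ n => some (n + 1)
  | left => fun _ n => some n.unpair.1
  | right => fun _ n => some n.unpair.2
  | query => fun τ n => τ[n]?
  | pair f h => fun τ n => (f.approx τ n).bind fun a => (h.approx τ n).map fun b => Nat.pair a b
  | comp f h => fun τ n => (h.approx τ n).bind fun a => f.approx τ a
  | prec f h => fun τ p =>
      Nat.rec (f.approx τ p.unpair.1)
        (fun y IH => IH.bind fun i => h.approx τ (Nat.pair p.unpair.1 (Nat.pair y i)))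
        p.unpair.2
  | rfind f => fun τ a =>
      (Nat.rec (some none) (fun j r => searchStep (fun n => f.approx τ (Nat.pair a n)) j r)
        τ.length : Option (Option ℕ)).bind id

theorem approx_primrec (c : OracleCode) : Primrec₂ c.approx := by
  induction c with
  | zero => exact (Primrec.const _).to₂
  | succ => exact (Primrec.option_some.comp (Primrec.succ.comp Primrec.snd)).to₂
  | left =>
    exact (Primrec.option_some.comp (Primrec.fst.comp (Primrec.unpair.comp Primrec.snd))).to₂
  | right =>
    exact (Primrec.option_some.comp (Primrec.snd.comp (Primrec.unpair.comp Primrec.snd))).to₂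
  | query => exact Primrec.list_getElem?
  | pair f h hf hh =>
    refine Primrec.option_bind hf (Primrec.option_map
      (hh.comp (Primrec.fst.comp Primrec.fst) (Primrec.snd.comp Primrec.fst)) ?_)
    exact (Primrec₂.natPair.comp (Primrec.snd.comp Primrec.fst) Primrec.snd)
  | comp f h hf hh =>
    exact Primrec.option_bind hh (hf.comp (Primrec.fst.comp Primrec.fst) Primrec.snd)
  | prec f h hf hh =>
    have hu : Primrec fun x : List ℕ × ℕ => x.2.unpair := Primrec.unpair.comp Primrec.snd
    refine Primrec.nat_rec' (f := fun x : List ℕ × ℕ => x.2.unpair.2)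
      (g := fun x => f.approx x.1 x.2.unpair.1)
      (h := fun x y => y.2.bind fun i =>
        h.approx x.1 (Nat.pair x.2.unpair.1 (Nat.pair y.1 i)))
      (Primrec.snd.comp hu) (hf.comp Primrec.fst (Primrec.fst.comp hu)) ?_
    refine Primrec.option_bind (Primrec.snd.comp Primrec.snd) (hh.comp ?_ ?_)
    · exact Primrec.fst.comp (Primrec.fst.comp Primrec.fst)
    · exact Primrec₂.natPair.comp (Primrec.fst.comp (hu.comp (Primrec.fst.comp Primrec.fst)))
        (Primrec₂.natPair.comp (Primrec.fst.comp (Primrec.snd.comp Primrec.fst)) Primrec.snd)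
  | rfind f hf =>
    refine Primrec.option_bind (Primrec.nat_rec' (f := fun x : List ℕ × ℕ => x.1.length)
      (g := fun _ => some none)
      (h := fun x y => searchStep (fun n => f.approx x.1 (Nat.pair x.2 n)) y.1 y.2)
      (Primrec.list_length.comp Primrec.fst) (Primrec.const _) ?_) (Primrec.id.comp Primrec.snd)
    refine Primrec.option_bind (Primrec.snd.comp Primrec.snd) ?_
    refine Primrec.option_casesOn Primrec.snd (Primrec.option_map (hf.comp ?_ ?_) ?_) ?_
    · exact Primrec.fst.comp (Primrec.fst.comp Primrec.fst)
    · exact Primrec₂.natPair.comp (Primrec.snd.comp (Primrec.fst.comp Primrec.fst))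
        (Primrec.fst.comp (Primrec.snd.comp Primrec.fst))
    · exact Primrec.ite (Primrec.eq.comp Primrec.snd (Primrec.const 0))
        (Primrec.option_some.comp
          (Primrec.fst.comp (Primrec.snd.comp (Primrec.fst.comp Primrec.fst))))
        (Primrec.const none)
    · exact (Primrec.option_some.comp (Primrec.option_some.comp Primrec.snd)).to₂

theorem search_sound (v : ℕ → Option ℕ) (l : ℕ) :
    (∀ k, (Nat.rec (some none) (searchStep v) l : Option (Option ℕ)) = some (some k) →
      v k = some 0 ∧ ∀ j < k, ∃ m, m ≠ 0 ∧ v j = some m) ∧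
    ((Nat.rec (some none) (searchStep v) l : Option (Option ℕ)) = some none →
      ∀ j < l, ∃ m, m ≠ 0 ∧ v j = some m) := by
  induction l with
  | zero => simp
  | succ l ih =>
    simp only
    generalize (Nat.rec (some none) (searchStep v) l : Option (Option ℕ)) = r at ih
    rcases r with _ | _ | m
    · simp [searchStep]
    · have h0 := ih.2 rfl
      cases hv : v l with
      | none => simp [searchStep, hv]
      | some m =>
        by_cases hm : m = 0
        · subst hm
          simp only [searchStep, hv]
          refine ⟨fun k hk => ?_, fun hk => by simp at hk⟩
          simp at hk
          subst hk
          exact ⟨hv, h0⟩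
        · simp only [searchStep, hv]
          refine ⟨fun k hk => by simp [hm] at hk, fun _ j hj => ?_⟩
          rcases Nat.lt_succ_iff_lt_or_eq.1 hj with h | rfl
          · exact h0 j h
          · exact ⟨m, hm, hv⟩
    · have h1 := ih.1 m rfl
      refine ⟨fun k hk => ?_, fun hk => by simp [searchStep] at hk⟩
      simp [searchStep] at hk
      subst hk
      exact h1

theorem search_complete (v : ℕ → Option ℕ) (k : ℕ) (h0 : v k = some 0)
    (hlt : ∀ j < k, ∃ m, m ≠ 0 ∧ v j = some m) (l : ℕ) :
    (Nat.rec (some none) (searchStep v) l : Option (Option ℕ)) =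
      if l ≤ k then some none else some (some k) := by
  induction l with
  | zero => simp
  | succ l ih =>
    simp only [ih]
    rcases lt_trichotomy l k with h | rfl | h
    · obtain ⟨m, hm, hv⟩ := hlt l h
      simp [searchStep, hv, hm, h.le, Nat.succ_le_of_lt h]
    · simp [searchStep, h0]
    · simp [searchStep, not_le.2 h, not_le.2 (h.trans (Nat.lt_succ_self l))]

theorem approx_sound (c : OracleCode) (X : Set ℕ) (l n m : ℕ)
    (h : c.approx (prefixList X l) n = some m) : m ∈ c.eval X n := by
  induction c generalizing n m with
  | zero => simpa [approx, eval, eq_comm] using h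
  | succ => simpa [approx, eval, eq_comm] using h
  | left => simpa [approx, eval, eq_comm] using h
  | right => simpa [approx, eval, eq_comm] using h
  | query =>
    simp only [approx, prefixList, List.getElem?_map, Option.map_eq_some_iff] at h
    obtain ⟨a, ha, rfl⟩ := h
    rw [List.getElem?_range] at ha
    · cases ha
      exact Part.mem_some _
    · by_contra hn
      rw [List.getElem?_eq_none (by simpa using hn)] at ha
      cases ha
  | pair f g hf hg =>
    simp only [approx, Option.bind_eq_some_iff, Option.map_eq_some_iff] at h
    obtain ⟨a, ha, b, hb, rfl⟩ := h
    have ha := hf _ _ ha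
    have hb := hg _ _ hb
    simp only [eval, Seq.seq]
    simp only [Part.map_eq_map, Part.mem_bind_iff, Part.mem_map_iff]
    exact ⟨_, ⟨a, ha, rfl⟩, b, hb, rfl⟩
  | comp f g hf hg =>
    simp only [approx, Option.bind_eq_some_iff] at h
    obtain ⟨a, ha, hb⟩ := h
    exact Part.mem_bind_iff.2 ⟨a, hg _ _ ha, hf _ _ hb⟩
  | prec f g hf hg =>
    simp only [approx, eval] at h ⊢
    generalize n.unpair.2 = k at h ⊢
    induction k generalizing m with
    | zero => exact hf _ _ h
    | succ k ih =>
      simp only [Option.bind_eq_some_iff] at h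
      obtain ⟨a, ha, hb⟩ := h
      exact Part.mem_bind_iff.2 ⟨a, ih _ ha, hg _ _ hb⟩
  | rfind f hf =>
    simp only [approx, Option.bind_eq_some_iff, id] at h
    obtain ⟨o, ho, rfl⟩ := h
    obtain ⟨h0, hlt⟩ := (search_sound _ _).1 m ho
    refine Nat.mem_rfind.2 ?_
    simp only [Part.map_eq_map, Part.mem_map_iff]
    refine ⟨⟨0, hf _ _ h0, by simp⟩, fun {j} hj => ?_⟩
    obtain ⟨a, ha, hv⟩ := hlt j hj
    exact ⟨a, hf _ _ hv, by simp [ha]⟩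

theorem approx_complete (c : OracleCode) (X : Set ℕ) (n m : ℕ) (h : m ∈ c.eval X n) :
    ∀ᶠ l in Filter.atTop, c.approx (prefixList X l) n = some m := by
  induction c generalizing n m with
  | zero => exact Filter.Eventually.of_forall fun _ => by simpa [approx, eval, eq_comm] using h
  | succ => exact Filter.Eventually.of_forall fun _ => by simpa [approx, eval, eq_comm] using h
  | left => exact Filter.Eventually.of_forall fun _ => by simpa [approx, eval, eq_comm] using h
  | right => exact Filter.Eventually.of_forall fun _ => by simpa [approx, eval, eq_comm] using h
  | query =>
    filter_upwards [Filter.eventually_gt_atTop n] with l hl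
    have h : m = setOracle X n := by simpa [eval] using h
    simp [approx, prefixList, List.getElem?_range hl, h]
  | pair f g hf hg =>
    simp only [eval, Seq.seq] at h
    simp only [Part.map_eq_map, Part.mem_bind_iff, Part.mem_map_iff] at h
    obtain ⟨_, ⟨a, ha, rfl⟩, b, hb, rfl⟩ := h
    filter_upwards [hf _ _ ha, hg _ _ hb] with l h1 h2
    simp [approx, h1, h2]
  | comp f g hf hg =>
    obtain ⟨a, ha, hb⟩ := Part.mem_bind_iff.1 h
    filter_upwards [hg _ _ ha, hf _ _ hb] with l h1 h2
    simp [approx, h1, h2]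
  | prec f g hf hg =>
    simp only [approx, eval] at h ⊢
    generalize n.unpair.2 = k at h ⊢
    induction k generalizing m with
    | zero => exact hf _ _ h
    | succ k ih =>
      obtain ⟨a, ha, hb⟩ := Part.mem_bind_iff.1 h
      filter_upwards [ih _ ha, hg _ _ hb] with l h1 h2
      simp only [h1, Option.bind_some, h2]
  | rfind f hf =>
    replace h := Nat.mem_rfind.1 h
    simp only [Part.map_eq_map, Part.mem_map_iff] at h
    obtain ⟨⟨z, hz, hz0⟩, hlt⟩ := h
    have hz0 : z = 0 := by simpa using hz0
    subst hz0
    have hlt' : ∀ᶠ l in Filter.atTop, ∀ j ∈ Finset.range m,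
        ∃ a, a ≠ 0 ∧ f.approx (prefixList X l) (Nat.pair n j) = some a := by
      rw [Filter.eventually_all_finset]
      intro j hj
      obtain ⟨a, ha, ha0⟩ := hlt (Finset.mem_range.1 hj)
      filter_upwards [hf _ _ ha] with l hl
      exact ⟨a, by simpa using ha0, hl⟩
    filter_upwards [hf _ _ hz, hlt', Filter.eventually_gt_atTop m] with l h1 h2 h3
    have := search_complete (fun j => f.approx (prefixList X l) (Nat.pair n j)) m h1
      (fun j hj => h2 j (Finset.mem_range.2 hj)) (prefixList X l).length
    simp only [approx]
    rw [this]
    simp [prefixList, not_le.2 h3]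

/-- An oracle program can search for the first `l` at which a computable function of the first
`l` bits of the oracle gives a result, and output that result. -/
theorem exists_code_search {G : List ℕ → ℕ → Option ℕ} (hG : Computable₂ G) :
    ∃ c : OracleCode, ∀ X n m, m ∈ c.eval X n ↔
      ∃ l, G (prefixList X l) n = some m ∧ ∀ j < l, G (prefixList X j) n = none := by
  obtain ⟨nil, hnil⟩ := exists_code_of_partrec 
    (Partrec.nat_iff.1 (Computable.const (α := ℕ) (Encodable.encode ([] : List ℕ))))
  have hsnoc : Computable fun x : ℕ => Encodable.encode
      (((Encodable.decode (α := List ℕ) x.unpair.1).getD []) ++ [x.unpair.2]) := by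
    refine (Primrec.encode.comp (Primrec.list_concat.comp (Primrec.option_getD.comp
      (Primrec.decode.comp ?_) (Primrec.const [])) ?_)).to_comp
    · exact Primrec.fst.comp Primrec.unpair
    · exact Primrec.snd.comp Primrec.unpair
  obtain ⟨snoc, hsn⟩ := exists_code_of_partrec (Partrec.nat_iff.1 hsnoc)
  let pre : OracleCode := prec nil (comp snoc (pair (comp right right)
    (comp query (comp left right))))
  have hpre : ∀ X a l, pre.eval X (Nat.pair a l) =
      Part.some (Encodable.encode (prefixList X l)) := by
    intro X a l
    simp only [pre, eval, Nat.unpair_pair]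
    induction l with
    | zero => simp [hnil, prefixList]
    | succ l ih =>
      simp only [ih]
      simp only [Seq.seq, hsn]
      simp [prefixList, List.range_succ]
      exact (Part.bind_some _ _).trans (by simp)
  have hS : Computable fun x : ℕ =>
      (Encodable.decode (α := List ℕ) x.unpair.1).bind fun τ => G τ x.unpair.2 :=
    Computable.option_bind
      (Computable.decode.comp (Computable.fst.comp Primrec.unpair.to_comp))
      (hG.comp Computable.snd
        (Computable.snd.comp (Primrec.unpair.to_comp.comp Computable.fst)))
  have hT : Computable fun x : ℕ => (cond ((Encodable.decode (α := List ℕ) x.unpair.1).bind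
      fun τ => G τ x.unpair.2).isSome 0 1 : ℕ) :=
    Computable.cond (Primrec.option_isSome.to_comp.comp hS)
      (Computable.const 0) (Computable.const 1)
  obtain ⟨T, hT⟩ := exists_code_of_partrec (Partrec.nat_iff.1 hT)
  obtain ⟨V, hV⟩ := exists_code_of_partrec (Partrec.nat_iff.1 (Computable.ofOption hS))
  have hpl : ∀ X a l, (pair pre left).eval X (Nat.pair a l) =
      Part.some (Nat.pair (Encodable.encode (prefixList X l)) a) := by
    intro X a l
    simp only [eval, Seq.seq]
    simp [hpre]
  refine ⟨comp V (comp (pair pre left)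
    (pair (pair left right) (rfind (comp T (pair pre left))))), fun X n m => ?_⟩
  have hval : ∀ l, V.eval X (Nat.pair (Encodable.encode (prefixList X l)) n) =
      (G (prefixList X l) n : Part ℕ) := fun l => by simp [hV]
  have htest : ∀ l, (comp T (pair pre left)).eval X (Nat.pair n l) =
      Part.some (cond (G (prefixList X l) n).isSome 0 1) := fun l => by
    change (pair pre left).eval X (Nat.pair n l) >>= T.eval X = _
    rw [hpl, hT]
    exact (Part.bind_some _ _).trans (by simp)
  have hfind : ∀ l, l ∈ (rfind (comp T (pair pre left))).eval X n ↔
      (G (prefixList X l) n).isSome = true ∧ ∀ j < l, G (prefixList X j) n = none := fun l => by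
    refine Nat.mem_rfind.trans ?_
    simp only [htest]
    simp only [Part.map_eq_map, Part.map_some, Part.mem_some_iff]
    refine and_congr ?_ (forall_congr' fun j => forall_congr' fun _ => ?_)
    · cases G (prefixList X l) n <;> simp
    · cases G (prefixList X j) n <;> simp
  have hid : (pair left right).eval X n = Part.some n := by
    simp only [eval, Seq.seq]
    simp
  have hmem : m ∈ (comp V (comp (pair pre left)
      (pair (pair left right) (rfind (comp T (pair pre left)))))).eval X n ↔
      ∃ l ∈ (rfind (comp T (pair pre left))).eval X n, G (prefixList X l) n = some m := by
    change m ∈ (((Nat.pair <$> (pair left right).eval X n) <*>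
      (rfind (comp T (pair pre left))).eval X n) >>= (pair pre left).eval X) >>= V.eval X ↔ _
    rw [hid]
    simp only [Seq.seq, Part.map_eq_map, Part.map_some, Part.bind_some]
    refine Part.mem_bind_iff.trans ⟨?_, ?_⟩
    · rintro ⟨a, ha, hm⟩
      obtain ⟨_, hb, ha⟩ := Part.mem_bind_iff.1 ha
      obtain ⟨l, hl, rfl⟩ := (Part.mem_map_iff _).1 hb
      rw [hpl, Part.mem_some_iff] at ha
      subst ha
      rw [hval] at hm
      exact ⟨l, hl, by simpa using hm⟩
    · rintro ⟨l, hl, hm⟩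
      refine ⟨_, Part.mem_bind_iff.2 ⟨_, (Part.mem_map_iff _).2 ⟨l, hl, rfl⟩,
        by rw [hpl]; exact Part.mem_some _⟩, ?_⟩
      rw [hval]
      simpa using hm
  rw [hmem]
  constructor
  · rintro ⟨l, hl, hm⟩
    exact ⟨l, hm, ((hfind l).1 hl).2⟩
  · rintro ⟨l, hm, hlt⟩
    exact ⟨l, (hfind l).2 ⟨by simp [hm], hlt⟩, hm⟩

/-- Universal oracle machines exist. -/
theorem exists_isUniversal : ∃ U : OracleCode, U.IsUniversal := by
  let G : List ℕ → ℕ → Option ℕ := fun τ n =>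
    (Encodable.decode (α := List Bool) n).bind fun q =>
      Nat.Partrec.Code.evaln τ.length.unpair.2
        (Denumerable.ofNat Nat.Partrec.Code (q.takeWhile id).length)
        (Encodable.encode (τ.take τ.length.unpair.1,
          Encodable.encode (q.drop ((q.takeWhile id).length + 1))))
  have hG : Computable₂ G := by
    have hlen : Primrec fun x : (List ℕ × ℕ) × List Bool => (x.2.takeWhile id).length :=
      Primrec.list_length.comp ((Primrec.list_takeWhile Primrec.id).comp Primrec.snd)
    have hu : Primrec fun x : (List ℕ × ℕ) × List Bool => x.1.1.length.unpair :=
      Primrec.unpair.comp (Primrec.list_length.comp (Primrec.fst.comp Primrec.fst))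
    refine Primrec.to_comp (Primrec.option_bind (Primrec.decode.comp Primrec.snd) ?_)
    refine Nat.Partrec.Code.primrec_evaln.comp (Primrec.pair (Primrec.pair (Primrec.snd.comp hu)
      ((Primrec.ofNat Nat.Partrec.Code).comp hlen)) (Primrec.encode.comp (Primrec.pair
        (Primrec.list_take.comp (Primrec.fst.comp hu) (Primrec.fst.comp Primrec.fst))
        (Primrec.encode.comp (Primrec.list_drop.comp (Primrec.succ.comp hlen) Primrec.snd)))))
  obtain ⟨U, hU⟩ := exists_code_search hG
  refine ⟨U, fun M => ?_⟩
  have hM : Partrec fun x : List ℕ × ℕ => (M.approx x.1 x.2 : Part ℕ) :=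
    Computable.ofOption M.approx_primrec.to_comp
  obtain ⟨e, he⟩ := Nat.Partrec.Code.exists_code.1 hM
  have he' : ∀ τ n m, m ∈ e.eval (Encodable.encode (τ, n)) ↔ M.approx τ n = some m := by
    intro τ n m
    rw [he]
    simp
  refine ⟨Encodable.encode e + 1, fun X p σ h => ?_⟩
  refine ⟨List.replicate (Encodable.encode e) true ++ false :: p, by simp; omega, ?_⟩
  have hGq : ∀ l, G (prefixList X l) (Encodable.encode
      (List.replicate (Encodable.encode e) true ++ false :: p)) =
      Nat.Partrec.Code.evaln l.unpair.2 e
        (Encodable.encode (prefixList X l.unpair.1, Encodable.encode p)) := by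
    intro l
    have h1 : ((List.replicate (Encodable.encode e) true ++ false :: p).takeWhile id).length =
        Encodable.encode e := by
      rw [List.takeWhile_append_of_pos (by simp)]
      simp
    have h2 : (List.replicate (Encodable.encode e) true ++ false :: p).drop
        (Encodable.encode e + 1) = p := by
      rw [← List.drop_drop, List.drop_left' (by simp)]
      rfl
    have h3 : (prefixList X l).length = l := by simp [prefixList]
    have h4 : (prefixList X l).take l.unpair.1 = prefixList X l.unpair.1 := by
      simp [prefixList, ← List.map_take, List.take_range, Nat.unpair_left_le]
    simp only [G, Encodable.encodek, Option.bind_some, h1, h2, h3, h4, Denumerable.ofNat_encode]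
  have hsound : ∀ l m, G (prefixList X l) (Encodable.encode
      (List.replicate (Encodable.encode e) true ++ false :: p)) = some m →
      m = Encodable.encode σ := by
    intro l m hm
    rw [hGq] at hm
    exact Part.mem_unique (M.approx_sound X _ _ _
      ((he' _ _ _).1 (Nat.Partrec.Code.evaln_sound hm))) h
  have hex : ∃ l, (G (prefixList X l) (Encodable.encode
      (List.replicate (Encodable.encode e) true ++ false :: p))).isSome = true := by
    obtain ⟨l, hl⟩ := (M.approx_complete X _ _ h).exists
    obtain ⟨k, hk⟩ := Nat.Partrec.Code.evaln_complete.1 ((he' _ _ _).2 hl)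
    refine ⟨Nat.pair l k, ?_⟩
    rw [hGq, Nat.unpair_pair, hk]
    rfl
  classical
  obtain ⟨m, hm⟩ := Option.isSome_iff_exists.1 (Nat.find_spec hex)
  refine (hU _ _ _).2 ⟨Nat.find hex, ?_, fun j hj => ?_⟩
  · rw [hm, hsound _ _ hm]
  · simpa using Nat.find_min hex hj

end OracleCode

end

/-! Let `p` be a shortest program for `σ` with oracle `0'`. A natural number `n` can carry two kinds
of information: its size is a stage in the enumeration of the halting problem, and its residue
modulo `2 ^ d` spells out `d` bits. Take `A` to be the set of all `n ≥ n₀` whose `d` lowest bits are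
the first `d` bits of `p`. Its lower density is at least `2⁻ᵈ`.

The computation of `σ` from `p` uses only a finite part of `0'`, so for large `n₀` every stage `n ≥
n₀` answers its queries correctly. Hence any single element of `A` supplies both a sufficient
approximation of `0'` and `d` bits of `p`. An infinite `B ⊆ A` lets a machine find such an element.
The machine never needs `n₀`; its input is only `d` and the remaining `|p| - d` bits of `p`. With
`d` about `log (1/δ)`, coding `d` in self-delimiting form costs the logarithmic term.

The stages are handled by `OracleCode.Outputs.eventually_approx_haltingStage`, the machine by
`OracleCode.exists_code_lowBits`, the density by `le_lowerDensity_residueClass`;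
`OracleCode.exists_familyComplexity_le` combines them. -/

/-! ### Binary digits -/

/-- The `d` lowest binary digits of `n`, least significant digit first. -/
def lowBits (d n : ℕ) : List Bool := (List.range d).map n.testBit

/-- The number with the given binary digits, least significant digit first. -/
def bitsValue (s : List Bool) : ℕ := s.foldr (fun b a => 2 * a + b.toNat) 0

theorem length_lowBits (d n : ℕ) : (lowBits d n).length = d := by simp [lowBits]

theorem lowBits_succ (d n : ℕ) : lowBits (d + 1) n = n.testBit 0 :: lowBits d (n / 2) := by
  simp [lowBits, List.range_succ_eq_map, Function.comp_def, Nat.testBit_succ]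

/-- Prescribing the `d` lowest bits thus amounts to prescribing a residue class modulo `2 ^ d`,
which is what makes the density computable. -/
theorem lowBits_mod (d n : ℕ) : lowBits d (n % 2 ^ d) = lowBits d n := by
  refine List.map_congr_left fun i hi => ?_
  rw [Nat.testBit_mod_two_pow, decide_eq_true (List.mem_range.1 hi), Bool.true_and]

theorem lowBits_bitsValue (s : List Bool) : lowBits s.length (bitsValue s) = s := by
  induction s with
  | nil => rfl
  | cons b s ih =>
    have h0 : (bitsValue (b :: s)).testBit 0 = b := by
      cases b <;> simp [bitsValue, Nat.testBit_zero, Nat.add_mod]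
    have h1 : bitsValue (b :: s) / 2 = bitsValue s := by
      cases b <;> simp [bitsValue]
      omega
    rw [List.length_cons, lowBits_succ, h0, h1, ih]

theorem bitsValue_lowBits (d n : ℕ) (h : n < 2 ^ d) : bitsValue (lowBits d n) = n := by
  induction d generalizing n with
  | zero => simp at h; simp [h, lowBits, bitsValue]
  | succ d ih =>
    have h2 : bitsValue (lowBits d (n / 2)) = n / 2 := ih _ (by rw [pow_succ] at h; omega)
    rw [lowBits_succ, bitsValue, List.foldr_cons]
    change 2 * bitsValue (lowBits d (n / 2)) + _ = n
    rw [h2, Nat.testBit_zero]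
    rcases Nat.mod_two_eq_zero_or_one n with h | h <;> simp [h] <;> omega

theorem lowBits_primrec : Primrec₂ lowBits := by
  have hpow : Primrec₂ fun a b : ℕ => a ^ b := Primrec₂.unpaired'.1 Nat.Primrec.pow
  have h : Primrec₂ fun d n : ℕ => (List.range d).map fun i => decide (n / 2 ^ i % 2 = 1) := by
    refine Primrec.list_map (Primrec.list_range.comp Primrec.fst) ?_
    have hmod : Primrec fun x : (ℕ × ℕ) × ℕ => x.1.2 / 2 ^ x.2 % 2 :=
      Primrec.nat_mod.comp (Primrec.nat_div.comp (Primrec.snd.comp Primrec.fst)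
        (hpow.comp (Primrec.const 2) Primrec.snd)) (Primrec.const 2)
    exact (Primrec.eq.comp hmod (Primrec.const 1)).decide
  exact h.of_eq fun d n => by simp [lowBits, Nat.testBit_eq_decide_div_mod_eq]

theorem bitsValue_primrec : Primrec bitsValue := by
  refine Primrec.list_foldr (f := fun s : List Bool => s) (g := fun _ => 0)
    (h := fun _ x => 2 * x.2 + x.1.toNat) Primrec.id (Primrec.const 0) ?_
  refine Primrec.nat_add.comp (Primrec.nat_mul.comp (Primrec.const 2)
    (Primrec.snd.comp Primrec.snd)) ?_
  exact (Primrec.dom_finite Bool.toNat).comp (Primrec.fst.comp Primrec.snd)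

/-! ### Self-delimiting codes -/

/-- A self-delimiting description of `d`, followed by `r`. -/
def headed (d : ℕ) (r : List Bool) : List Bool :=
  -- The unary block announces how many binary digits of `d` follow the `false`, so the overhead is
  -- only `2 * d.size + 1`.
  List.replicate d.size true ++ false :: (lowBits d.size d ++ r)

theorem length_headed (d : ℕ) (r : List Bool) :
    (headed d r).length = 2 * d.size + 1 + r.length := by
  simp [headed, length_lowBits]; omega

/-- The number of leading `true`s. -/
def headLength (q : List Bool) : ℕ := (q.takeWhile id).length

/-- The number described by the head of `q`. -/
def headValue (q : List Bool) : ℕ :=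
  bitsValue ((q.drop (headLength q + 1)).take (headLength q))

/-- What follows the head of `q`. -/
def headTail (q : List Bool) : List Bool := (q.drop (headLength q + 1)).drop (headLength q)

theorem headLength_headed (d : ℕ) (r : List Bool) : headLength (headed d r) = d.size := by
  rw [headLength, headed, List.takeWhile_append_of_pos (by simp)]
  simp

theorem drop_headed (d : ℕ) (r : List Bool) :
    (headed d r).drop (d.size + 1) = lowBits d.size d ++ r := by
  rw [headed, ← List.drop_drop, List.drop_left' (by simp)]
  rfl

theorem headValue_headed (d : ℕ) (r : List Bool) : headValue (headed d r) = d := by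
  rw [headValue, headLength_headed, drop_headed, List.take_left' (length_lowBits _ _),
    bitsValue_lowBits _ _ (Nat.lt_size_self d)]

theorem headTail_headed (d : ℕ) (r : List Bool) : headTail (headed d r) = r := by
  rw [headTail, headLength_headed, drop_headed, List.drop_left' (length_lowBits _ _)]

theorem headLength_primrec : Primrec headLength :=
  Primrec.list_length.comp (Primrec.list_takeWhile Primrec.id)

theorem headValue_primrec : Primrec headValue :=
  bitsValue_primrec.comp (Primrec.list_take.comp headLength_primrec
    (Primrec.list_drop.comp (Primrec.succ.comp headLength_primrec) Primrec.id))

theorem headTail_primrec : Primrec headTail :=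
  Primrec.list_drop.comp headLength_primrec
    (Primrec.list_drop.comp (Primrec.succ.comp headLength_primrec) Primrec.id)

/-! ### Approximating the halting problem -/

/-- The membership function of the halting problem below `n`, as far as it is known after `n`
steps. -/
def haltingStage (n : ℕ) : List ℕ :=
  (List.range n).map fun j =>
    cond (Nat.Partrec.Code.evaln n (Denumerable.ofNat Nat.Partrec.Code j) j).isSome 1 0

theorem haltingStage_primrec : Primrec haltingStage := by
  refine Primrec.list_map Primrec.list_range (Primrec.cond (Primrec.option_isSome.comp ?_)
    (Primrec.const 1) (Primrec.const 0))
  exact Nat.Partrec.Code.primrec_evaln.comp (Primrec.pair (Primrec.pair Primrec.fst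
    ((Primrec.ofNat Nat.Partrec.Code).comp Primrec.snd)) Primrec.snd)

/-- Bounded evaluation is sound and monotone in the bound: a halting `j` is recognised from some
stage on, and a non-halting `j` is never accepted. -/
theorem eventually_evaln_isSome_eq (j : ℕ) : ∀ᶠ n in Filter.atTop,
    cond (Nat.Partrec.Code.evaln n (Denumerable.ofNat Nat.Partrec.Code j) j).isSome 1 0 =
      setOracle zeroJump j := by
  by_cases hj : j ∈ zeroJump
  · obtain ⟨m, hm⟩ := Part.dom_iff_mem.1 hj
    obtain ⟨k, hk⟩ := Nat.Partrec.Code.evaln_complete.1 hm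
    filter_upwards [Filter.eventually_ge_atTop k] with n hn
    have h : Nat.Partrec.Code.evaln n (Denumerable.ofNat Nat.Partrec.Code j) j = some m :=
      Nat.Partrec.Code.evaln_mono hn hk
    simp [h, setOracle, hj]
  · refine Filter.Eventually.of_forall fun n => ?_
    cases h : Nat.Partrec.Code.evaln n (Denumerable.ofNat Nat.Partrec.Code j) j with
    | none => simp [setOracle, hj]
    | some m => exact absurd (Part.dom_iff_mem.2 ⟨m, Nat.Partrec.Code.evaln_sound h⟩) hj

/-- Every initial segment of the halting problem is eventually approximated correctly. -/
theorem eventually_prefixList_isPrefix_haltingStage (l : ℕ) : ∀ᶠ n in Filter.atTop,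
    OracleCode.prefixList zeroJump l <+: haltingStage n := by
  have h : ∀ᶠ n in Filter.atTop, ∀ j ∈ Finset.range l,
      cond (Nat.Partrec.Code.evaln n (Denumerable.ofNat Nat.Partrec.Code j) j).isSome 1 0 =
        setOracle zeroJump j :=
    (Filter.eventually_all_finset _).2 fun j _ => eventually_evaln_isSome_eq j
  filter_upwards [h, Filter.eventually_ge_atTop l] with n hn hl
  have : OracleCode.prefixList zeroJump l = (haltingStage n).take l := by
    rw [haltingStage, ← List.map_take, List.take_range, min_eq_left hl, OracleCode.prefixList]
    exact List.map_congr_left fun j hj => (hn j (by simpa using hj)).symm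
  rw [this]
  exact List.take_prefix _ _

/-! ### Decoding from an element of the oracle -/

namespace OracleCode

/-- Lengthening the oracle prefix keeps every answer already given and only raises the bound on
searches. This is what allows `haltingStage n` to be wrong beyond the part that a computation uses.
-/
theorem approx_mono (c : OracleCode) {τ υ : List ℕ} (hτ : τ <+: υ) {n m : ℕ}
    (h : c.approx τ n = some m) : c.approx υ n = some m := by
  induction c generalizing n m with
  | zero => exact h
  | succ => exact h
  | left => exact h
  | right => exact h
  | query =>
    obtain ⟨υ, rfl⟩ := hτ
    obtain ⟨hn, _⟩ := List.getElem?_eq_some_iff.1 h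
    exact (List.getElem?_append_left hn).trans h
  | pair f g hf hg =>
    simp only [approx, Option.bind_eq_some_iff, Option.map_eq_some_iff] at h ⊢
    obtain ⟨a, ha, b, hb, rfl⟩ := h
    exact ⟨a, hf ha, b, hg hb, rfl⟩
  | comp f g hf hg =>
    simp only [approx, Option.bind_eq_some_iff] at h ⊢
    obtain ⟨a, ha, hb⟩ := h
    exact ⟨a, hg ha, hf hb⟩
  | prec f g hf hg =>
    simp only [approx] at h ⊢
    generalize n.unpair.2 = k at h ⊢
    induction k generalizing m with
    | zero => exact hf h
    | succ k ih =>
      simp only [Option.bind_eq_some_iff] at h ⊢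
      obtain ⟨a, ha, hb⟩ := h
      exact ⟨a, ih ha, hg hb⟩
  | rfind f hf =>
    simp only [approx, Option.bind_eq_some_iff, id] at h ⊢
    obtain ⟨o, ho, rfl⟩ := h
    obtain ⟨h0, hlt⟩ := (search_sound _ _).1 m ho
    -- Had the bound not exceeded `m`, the search would still be undecided, with value `some none`.
    have hm : m < τ.length := by
      by_contra hm
      rw [search_complete _ m h0 hlt, if_pos (not_lt.1 hm)] at ho
      cases ho
    refine ⟨_, (search_complete (fun j => f.approx υ (Nat.pair n j)) m (hf h0)
      (fun j hj => ?_) _).trans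
      (if_neg (not_le.2 (hm.trans_le hτ.length_le))), rfl⟩
    obtain ⟨a, ha, hv⟩ := hlt j hj
    exact ⟨a, ha, hf hv⟩

/-- Given the output of `U` on `p` with oracle `0'`, large `n` allow to compute it. -/
theorem Outputs.eventually_approx_haltingStage {U : OracleCode} {p σ : List Bool}
    (h : U.Outputs zeroJump p σ) : ∀ᶠ n in Filter.atTop,
      U.approx (haltingStage n) (Encodable.encode p) = some (Encodable.encode σ) := by
  obtain ⟨l, hl⟩ := (U.approx_complete _ _ _ h).exists
  filter_upwards [eventually_prefixList_isPrefix_haltingStage l] with n hn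
  exact U.approx_mono hn hl

/-- There is an oracle machine that finds an element `n` of the oracle and runs `U` on the
program whose first `d` bits are those of `n`, with an approximation of `0'` computed from `n`. -/
theorem exists_code_lowBits (U : OracleCode) : ∃ M : OracleCode, ∀ (B : Set ℕ) (d : ℕ)
    (r σ : List Bool), B.Nonempty →
    (∀ n ∈ B, U.approx (haltingStage n) (Encodable.encode (lowBits d n ++ r)) =
      some (Encodable.encode σ)) → M.Outputs B (headed d r) σ := by
  -- A prefix of length `n + 1` whose last bit is 1 exhibits the element `n = τ.length - 1` of the
  -- oracle; this `n` serves both as stage and as source of bits. The empty prefix has no last bit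
  -- and fails the test.
  let G : List ℕ → ℕ → Option ℕ := fun τ x =>
    (Encodable.decode (α := List Bool) x).bind fun q =>
      if τ.reverse.head? = some 1 then
        U.approx (haltingStage (τ.length - 1))
          (Encodable.encode (lowBits (headValue q) (τ.length - 1) ++ headTail q))
      else none
  have hG : Computable₂ G := by
    have hτ : Primrec fun x : (List ℕ × ℕ) × List Bool => x.1.1 :=
      Primrec.fst.comp Primrec.fst
    have hn : Primrec fun x : (List ℕ × ℕ) × List Bool => x.1.1.length - 1 :=
      Primrec.pred.comp (Primrec.list_length.comp hτ)
    refine Primrec.to_comp (Primrec.option_bind (Primrec.decode.comp Primrec.snd)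
      (Primrec.ite (Primrec.eq.comp (Primrec.list_head?.comp (Primrec.list_reverse.comp hτ))
        (Primrec.const (some 1))) ?_ (Primrec.const none)))
    refine U.approx_primrec.comp (haltingStage_primrec.comp hn) (Primrec.encode.comp
      (Primrec.list_append.comp (lowBits_primrec.comp (headValue_primrec.comp Primrec.snd) hn)
        (headTail_primrec.comp Primrec.snd)))
  obtain ⟨M, hM⟩ := exists_code_search hG
  refine ⟨M, fun B d r σ hne hB => ?_⟩
  have hsucc : ∀ n, G (prefixList B (n + 1)) (Encodable.encode (headed d r)) =
      if setOracle B n = 1 then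
        U.approx (haltingStage n) (Encodable.encode (lowBits d n ++ r)) else none := by
    intro n
    simp [G, prefixList, List.range_succ, headValue_headed, headTail_headed]
  have hmem : ∀ n, setOracle B n = 1 ↔ n ∈ B := fun n => by simp [setOracle]
  have hsome : ∀ l m, G (prefixList B l) (Encodable.encode (headed d r)) = some m →
      m = Encodable.encode σ := by
    intro l m h
    cases l with
    | zero => simp [G, prefixList] at h
    | succ n =>
      rw [hsucc] at h
      by_cases hn : n ∈ B
      · rw [if_pos ((hmem n).2 hn), hB n hn] at h
        exact (Option.some.inj h).symm
      · simp [hmem, hn] at h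
  have hex : ∃ l, (G (prefixList B l) (Encodable.encode (headed d r))).isSome = true := by
    obtain ⟨n, hn⟩ := hne
    exact ⟨n + 1, by rw [hsucc, if_pos ((hmem n).2 hn), hB n hn]; rfl⟩
  classical
  obtain ⟨m, hm⟩ := Option.isSome_iff_exists.1 (Nat.find_spec hex)
  refine (hM _ _ _).2 ⟨Nat.find hex, ?_, fun j hj => ?_⟩
  · rw [hm, hsome _ _ hm]
  · simpa using Nat.find_min hex hj

end OracleCode

/-! ### Density of residue classes -/

/-- The numbers from `n₀` on in a residue class modulo `N` have lower density `1 / N`. -/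
theorem le_lowerDensity_residueClass (N v n₀ : ℕ) (hv : v < N) :
    (1 / N : ℝ) ≤ lowerDensity {n | n₀ ≤ n ∧ n % N = v} := by
  have hN : 0 < N := by omega
  have hcount : ∀ n : ℕ, (n + 1) / N - n₀ ≤ ({n | n₀ ≤ n ∧ n % N = v} ∩ Set.Iic n).ncard := by
    intro n
    -- Starting the multiples of `N` at `n₀` puts every listed element above `n₀`, at the cost of at
    -- most `n₀` members of the class.
    have hinj : Function.Injective fun i => (n₀ + i) * N + v := fun i j h => by
      simpa [hN.ne'] using h
    have hsub : (fun i => (n₀ + i) * N + v) '' (Finset.range ((n + 1) / N - n₀) : Set ℕ) ⊆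
        {n | n₀ ≤ n ∧ n % N = v} ∩ Set.Iic n := by
      rintro _ ⟨i, hi, rfl⟩
      have hi : i < (n + 1) / N - n₀ := by simpa using hi
      have h1 : (n₀ + i + 1) * N ≤ n + 1 :=
        (Nat.mul_le_mul_right N (by omega)).trans (Nat.div_mul_le_self _ _)
      rw [add_mul, one_mul] at h1
      have h2 : n₀ + i ≤ (n₀ + i) * N := Nat.le_mul_of_pos_right _ hN
      refine ⟨⟨?_, ?_⟩, ?_⟩
      · show n₀ ≤ (n₀ + i) * N + v
        omega
      · simp [Nat.add_mod, Nat.mod_eq_of_lt hv]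
      · show (n₀ + i) * N + v ≤ n
        omega
    have h := Set.ncard_le_ncard hsub ((Set.finite_Iic n).inter_of_right _)
    rwa [Set.ncard_image_of_injective _ hinj, Set.ncard_coe_finset, Finset.card_range] at h
  -- In the error term, `n₀` counts the omitted members and 1 comes from rounding down `(n + 1) /
  -- N`.
  have hbound : ∀ n : ℕ, (1 / N : ℝ) - (n₀ + 1) / (n + 1) ≤
      ({n | n₀ ≤ n ∧ n % N = v} ∩ Set.Iic n).ncard / (n + 1) := by
    intro n
    have hn : (0 : ℝ) < n + 1 := by positivity
    have hN' : (0 : ℝ) < N := by exact_mod_cast hN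
    have h1 : ((n + 1) / N : ℝ) - (n₀ + 1) ≤
        ({n | n₀ ≤ n ∧ n % N = v} ∩ Set.Iic n).ncard := by
      have h2 : ((n + 1 : ℕ) : ℝ) < N * ((n + 1) / N : ℕ) + N := by
        exact_mod_cast Nat.lt_mul_div_succ (n + 1) hN
      have h3 : ((n + 1) / N : ℝ) ≤ ((n + 1) / N : ℕ) + 1 := by
        rw [div_le_iff₀ hN']
        push_cast at h2
        linarith
      have h4 : (((n + 1) / N : ℕ) : ℝ) ≤
          ({n | n₀ ≤ n ∧ n % N = v} ∩ Set.Iic n).ncard + n₀ := by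
        exact_mod_cast Nat.sub_le_iff_le_add.1 (hcount n)
      linarith
    rw [le_div_iff₀ hn, sub_mul, div_mul_cancel₀ _ hn.ne', one_div_mul_eq_div]
    exact h1
  have hlim : Filter.Tendsto (fun n : ℕ => (1 / N : ℝ) - (n₀ + 1) / (n + 1)) Filter.atTop
      (nhds (1 / N)) := by
    have h := (tendsto_one_div_add_atTop_nhds_zero_nat (𝕜 := ℝ)).const_mul (n₀ + 1 : ℝ)
    simpa [div_eq_mul_inv] using h.const_sub (1 / N : ℝ)
  -- The real `liminf` is monotone only under boundedness conditions; this bound provides one of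
  -- them.
  have hone : ∀ n : ℕ,
      (({n | n₀ ≤ n ∧ n % N = v} ∩ Set.Iic n).ncard : ℝ) / (n + 1) ≤ 1 := by
    intro n
    rw [div_le_one (by positivity)]
    have h := Set.ncard_le_ncard (Set.inter_subset_right (s := {n | n₀ ≤ n ∧ n % N = v}))
      (Set.finite_Iic n)
    have h2 : (Set.Iic n).ncard = n + 1 := by
      rw [← Finset.coe_Iic, Set.ncard_coe_finset, Nat.card_Iic]
    rw [h2] at h
    exact_mod_cast h
  calc (1 / N : ℝ) = Filter.liminf (fun n : ℕ => (1 / N : ℝ) - (n₀ + 1) / (n + 1))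
        Filter.atTop := hlim.liminf_eq.symm
    _ ≤ _ := Filter.liminf_le_liminf (Filter.Eventually.of_forall hbound)
      hlim.isBoundedUnder_ge
      (Filter.isBoundedUnder_of ⟨1, hone⟩).isCoboundedUnder_ge

/-! ### The complexity bound -/

namespace OracleCode

/-- A program for `0'` of length at least `d` can be shortened by `d` bits for the infinite
subsets of a suitable set of lower density `2⁻ᵈ`. -/
theorem exists_familyComplexity_le (U : OracleCode) (hU : U.IsUniversal) :
    ∃ e : ℕ, ∀ (p σ : List Bool) (d : ℕ), U.Outputs zeroJump p σ → d ≤ p.length →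
      ∃ A : Set ℕ, (1 / 2 ^ d : ℝ) ≤ lowerDensity A ∧
        U.familyComplexity (infiniteSubsets A) σ ≤
          ((2 * d.size + (p.length - d) + e : ℕ) : ℕ∞) := by
  obtain ⟨M, hM⟩ := U.exists_code_lowBits
  obtain ⟨e, he⟩ := hU M
  -- The extra 1 pays for the delimiter in `headed`.
  refine ⟨e + 1, fun p σ d hp hd => ?_⟩
  obtain ⟨n₀, hn₀⟩ := Filter.eventually_atTop.1 hp.eventually_approx_haltingStage
  have hlen : (p.take d).length = d := by simpa using hd
  -- Reducing `bitsValue` modulo `2 ^ d` makes the residue bound immediate and, by `lowBits_mod`,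
  -- leaves the `d` lowest digits unchanged.
  refine ⟨{n | n₀ ≤ n ∧ n % 2 ^ d = bitsValue (p.take d) % 2 ^ d}, ?_, ?_⟩
  · have h := le_lowerDensity_residueClass (2 ^ d) (bitsValue (p.take d) % 2 ^ d) n₀
      (Nat.mod_lt _ (by positivity))
    simpa using h
  · refine iSup₂_le fun B hB => ?_
    have hout : M.Outputs B (headed d (p.drop d)) σ := by
      refine hM B d _ σ hB.2.nonempty fun n hn => ?_
      obtain ⟨h1, h2⟩ := hB.1 hn
      have hbits : lowBits d n = p.take d := by
        conv_rhs => rw [← lowBits_bitsValue (p.take d), hlen]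
        rw [← lowBits_mod, h2, lowBits_mod]
      rw [hbits, List.take_append_drop]
      exact hn₀ n h1
    obtain ⟨q, hq, hUq⟩ := he B _ _ hout
    refine (iInf₂_le q hUq).trans (Nat.cast_le.2 (hq.trans ?_))
    rw [length_headed, List.length_drop]
    omega

end OracleCode

theorem mainTheorem4 (U : OracleCode) (hU : U.IsUniversal) :
    ∃ c : ℝ, ∀ (σ : List Bool) (δ : ℝ), 0 < δ → δ ≤ 1 →
      ∃ A : Set ℕ, δ ≤ lowerDensity A ∧
        (((U.familyComplexity (infiniteSubsets A) σ : ℕ∞) : ℝ≥0∞) : EReal) ≤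
          max 0 ((((U.complexity zeroJump σ : ℕ∞) : ℝ≥0∞) : EReal) -
              ((Real.logb 2 (1 / δ) : ℝ) : EReal)) +
            ((c * Real.logb 2 (2 + Real.logb 2 (1 / δ)) : ℝ) : EReal) := by
  obtain ⟨e, he⟩ := U.exists_familyComplexity_le hU
  -- With `L = log (2 + log (1/δ)) ≥ 1`, coding `d` costs at most `2 * L + 2` and rounding costs 1;
  -- together with `e` this is at most `(e + 5) * L`.
  refine ⟨e + 5, fun σ δ hδ hδ1 => ?_⟩
  by_cases hex : ∃ p, U.Outputs zeroJump p σ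
  swap
  · have htop : U.complexity zeroJump σ = ⊤ := by
      simp only [OracleCode.complexity, iInf_eq_top]
      exact fun p hp => absurd ⟨p, hp⟩ hex
    -- This set is all of `ℕ`; the right-hand side is infinite here.
    refine ⟨{n | 0 ≤ n ∧ n % 1 = 0}, hδ1.trans ?_, ?_⟩
    · simpa using le_lowerDensity_residueClass 1 0 0 one_pos
    · rw [htop, ENat.toENNReal_top, EReal.coe_ennreal_top, EReal.top_sub_coe,
        max_eq_right le_top, EReal.top_add_coe]
      exact le_top
  obtain ⟨p, hp, hmin⟩ : ∃ p, U.Outputs zeroJump p σ ∧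
      (p.length : ℕ∞) ≤ U.complexity zeroJump σ := by
    classical
    have hlen : ∃ n, ∃ p, U.Outputs zeroJump p σ ∧ p.length = n :=
      hex.imp' List.length fun p hp => ⟨p, hp, rfl⟩
    obtain ⟨p, hp, hpn⟩ := Nat.find_spec hlen
    refine ⟨p, hp, le_iInf₂ fun q hq => Nat.cast_le.2 ?_⟩
    rw [hpn]
    exact Nat.find_min' hlen ⟨q, hq, rfl⟩
  set s := Real.logb 2 (1 / δ) with hs
  have hs0 : 0 ≤ s := Real.logb_nonneg one_lt_two (by rwa [le_div_iff₀ hδ, one_mul])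
  have hfloor := Nat.floor_le hs0
  have hfloor1 := Nat.lt_floor_add_one s
  -- At most `|p|` bits can be saved; when `|p|` is the minimum nothing of `p` remains, which gives
  -- the 0 in the maximum.
  set d := min ⌊s⌋₊ p.length with hd
  have hds : (d : ℝ) ≤ s := le_trans (by exact_mod_cast min_le_left _ _) hfloor
  obtain ⟨A, hA, hCA⟩ := he p σ d hp (min_le_right _ _)
  refine ⟨A, le_trans ?_ hA, ?_⟩
  · have h : δ = 1 / 2 ^ s := by
      rw [hs, Real.rpow_logb two_pos (by norm_num) (by positivity), one_div_one_div]
    rw [h, ← Real.rpow_natCast]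
    exact one_div_le_one_div_of_le (by positivity)
      (Real.rpow_le_rpow_of_exponent_le one_le_two hds)
  have hlog1 : 1 ≤ Real.logb 2 (2 + s) := by
    rw [Real.le_logb_iff_rpow_le one_lt_two (by linarith)]
    simpa using hs0
  have hsize : (d.size : ℝ) ≤ Real.logb 2 (2 + s) + 1 := by
    -- Size 0 is treated apart because `d.size - 1` is truncated; otherwise `2 ^ (d.size - 1) ≤ d ≤
    -- s`.
    rcases Nat.eq_zero_or_pos d.size with h | h
    · rw [h, Nat.cast_zero]
      linarith
    · have h2 : 2 ^ (d.size - 1) ≤ d := Nat.lt_size.1 (by omega)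
      have h3 : ((d.size - 1 : ℕ) : ℝ) ≤ Real.logb 2 (2 + s) := by
        rw [Real.le_logb_iff_rpow_le one_lt_two (by linarith), Real.rpow_natCast]
        have : ((2 : ℝ) ^ (d.size - 1)) ≤ d := by exact_mod_cast h2
        linarith
      rw [Nat.cast_sub h] at h3
      push_cast at h3
      linarith
  have hdiff : ((p.length - d : ℕ) : ℝ) ≤ max 0 (p.length - s) + 1 := by
    rw [Nat.cast_sub (min_le_right _ _)]
    rcases min_choice ⌊s⌋₊ p.length with h | h
    · rw [h]
      linarith [le_max_right 0 (p.length - s)]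
    · rw [h]
      linarith [le_max_left 0 (p.length - s)]
  have hreal : ((2 * d.size + (p.length - d) + e : ℕ) : ℝ) ≤
      max 0 (p.length - s) + (e + 5) * Real.logb 2 (2 + s) := by
    push_cast
    have : (e : ℝ) ≤ e * Real.logb 2 (2 + s) := le_mul_of_one_le_right (by positivity) hlog1
    linarith
  have hcast : ∀ m : ℕ, (((m : ℕ∞) : ℝ≥0∞) : EReal) = ((m : ℝ) : EReal) := fun m => by
    rw [ENat.toENNReal_coe, EReal.coe_coe_eq_natCast, ← ENNReal.coe_natCast]
    rfl
  calc (((U.familyComplexity (infiniteSubsets A) σ : ℕ∞) : ℝ≥0∞) : EReal)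
      ≤ (((2 * d.size + (p.length - d) + e : ℕ) : ℝ) : EReal) := by
        have h : ((U.familyComplexity (infiniteSubsets A) σ : ℕ∞) : ℝ≥0∞) ≤
            (((2 * d.size + (p.length - d) + e : ℕ) : ℕ∞) : ℝ≥0∞) :=
          ENat.toENNReal_le.2 hCA
        exact (EReal.coe_ennreal_le_coe_ennreal_iff.2 h).trans_eq (hcast _)
    _ ≤ ((max 0 (p.length - s) + (e + 5) * Real.logb 2 (2 + s) : ℝ) : EReal) :=
        EReal.coe_le_coe_iff.2 hreal
    _ ≤ _ := by
        rw [EReal.coe_add, EReal.coe_strictMono.monotone.map_max, EReal.coe_sub, EReal.coe_zero,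
          ← hcast]
        have h : (((p.length : ℕ∞) : ℝ≥0∞) : EReal) ≤
            (((U.complexity zeroJump σ : ℕ∞) : ℝ≥0∞) : EReal) :=
          EReal.coe_ennreal_le_coe_ennreal_iff.2 (ENat.toENNReal_le.2 hmin)
        exact add_le_add (max_le_max le_rfl (EReal.sub_le_sub h le_rfl)) le_rfl
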